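/- For every integer $n\ge 2$ let $S_n=\sum_{l=1}^{n-1}\csc\frac{\pi l}{n}$, let $H_n=\sum_{k=1}^{n}\frac1k$ be the $n$th harmonic number, and let $\gamma$ be Euler's constant. Put $$A=\frac{\pi}{36}-\frac{1}{6\pi}=0.0342\ldots,\qquad B=\frac{7\pi^3}{21600}-\frac{1}{60\pi}=0.00474\ldots,\qquad C=\frac{\pi}{36}=0.0872\ldots,\qquad D=\frac{7\pi^3}{21600}=0.0100\ldots$$ (leading decimals). Then for every integer $n\ge2$, $$-\frac{A}{n}<S_n-\frac{2n}{\pi}\left(H_n-\ln\frac{\pi}{2}\right)+\frac1\pi<-\frac{A}{n}+\frac{B}{n^3}$$ and $$-\frac{C}{n}<S_n-\frac{2n}{\pi}\left(\ln\frac{2n}{\pi}+\gamma\right)<-\frac{C}{n}+\frac{D}{n^3}.$$ Moreover, the bounds for $S_n$ given by the first pair of inequalities are more accurate than those given by the second pair: for every integer $n\ge 2$, $$\frac{2n}{\pi}\left(\ln\frac{2n}{\pi}+\gamma\right)-\frac Cn<\frac{2n}{\pi}\left(H_n-\ln\frac{\pi}{2}\right)-\frac1\pi-\frac An$$ and $$\frac{2n}{\pi}\left(H_n-\ln\frac{\pi}{2}\right)-\frac1\pi-\frac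 An+\frac B{n^3}<\frac{2n}{\pi}\left(\ln\frac{2n}{\pi}+\gamma\right)-\frac Cn+\frac D{n^3}.$$ -/

import Mathlib

/-- The sum of cosecants `S_n = ∑_{l=1}^{n-1} csc (π l / n)`. For `1 ≤ l ≤ n - 1` the angle
`π l / n` lies strictly between `0` and `π`, so every sine that occurs is positive. -/
noncomputable def cscSum (n : ℕ) : ℝ :=
  ∑ l ∈ Finset.Ico 1 n, 1 / Real.sin (Real.pi * (l : ℝ) / (n : ℝ))

/-- The constant `A = π/36 - 1/(6π)`. -/
noncomputable def constA : ℝ := Real.pi / 36 - 1 / (6 * Real.pi)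

/-- The constant `B = 7π³/21600 - 1/(60π)`. -/
noncomputable def constB : ℝ := 7 * Real.pi ^ 3 / 21600 - 1 / (60 * Real.pi)

/-- The constant `C = π/36`. -/
noncomputable def constC : ℝ := Real.pi / 36

/-- The constant `D = 7π³/21600`. -/
noncomputable def constD : ℝ := 7 * Real.pi ^ 3 / 21600

/-- The main term with the harmonic number, `(2n/π) (H_n - ln (π/2)) - 1/π`. -/
noncomputable def harmonicMain (n : ℕ) : ℝ :=
  2 * (n : ℝ) / Real.pi * ((harmonic n : ℝ) - Real.log (Real.pi / 2)) - 1 / Real.pi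

/-- The main term with the logarithm, `(2n/π) (ln (2n/π) + γ)`. -/
noncomputable def logMain (n : ℕ) : ℝ :=
  2 * (n : ℝ) / Real.pi * (Real.log (2 * (n : ℝ) / Real.pi) + Real.eulerMascheroniConstant)

open Filter Topology

/-! Write `b_k` for `blockSum n k`. Partial fractions of `π csc (π x)` at `x = l / n`, summed over
`l`, give `π S_n / (2n) = b_0 + ∑ (b_{2i+2} - b_{2i+1})` (`tendsto_cscSum`). Keep `b_0 = H_n - 1/n`
exact and expand the other blocks by Euler–Maclaurin: the logarithms form Wallis's product, the
`1/m` terms telescope, and the `1/m²` terms give `ζ(2)`, hence `A`. What remains is a sum of second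
differences of `harmonicTail` (`tendsto_sum_blockSecondDiff`). These are positive, which is the
lower bound; so are those of `1/(120 m⁴) - harmonicTail m`, which with `ζ(4)` is the upper bound.
Positivity of the same two sequences at `n` compares the two main terms, and the logarithmic bounds
follow. -/

/-! ### Convexity of the Euler–Maclaurin remainder -/

/-- A real sequence tending to `0` whose successive decrements strictly decrease from index `1` on
is positive from index `1` on. -/
theorem pos_of_decrement_strictAnti {D : ℕ → ℝ}
    (hD : ∀ m, 1 ≤ m → D (m + 1) - D (m + 2) < D m - D (m + 1))
    (h0 : Tendsto D atTop (𝓝 0)) :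
    (∀ m, 1 ≤ m → 0 < D m) ∧ ∀ m n, 1 ≤ m → 1 ≤ n → 0 < D (m + 2 * n) - 2 * D (m + n) + D m := by
  have hanti : StrictAnti fun m ↦ D (m + 1) - D (m + 2) :=
    strictAnti_nat_of_succ_lt fun m ↦ hD (m + 1) (by omega)
  have hlim : Tendsto (fun m ↦ D (m + 1) - D (m + 2)) atTop (𝓝 0) := by
    simpa using ((tendsto_add_atTop_iff_nat 1).2 h0).sub ((tendsto_add_atTop_iff_nat 2).2 h0)
  have hdec : StrictAnti fun m ↦ D (m + 1) :=
    strictAnti_nat_of_succ_lt fun m ↦ by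
      have h1 := hanti.antitone.le_of_tendsto hlim (m + 1)
      have h2 := hanti (Nat.lt_succ_self m)
      simp only [Nat.succ_eq_add_one] at h1 h2
      linarith
  refine ⟨fun m hm ↦ ?_, fun m n hm hn ↦ ?_⟩
  · obtain ⟨k, rfl⟩ : ∃ k, m = k + 1 := ⟨m - 1, by omega⟩
    have h1 := hdec.antitone.le_of_tendsto ((tendsto_add_atTop_iff_nat 1).2 h0) (k + 1)
    exact h1.trans_lt (hdec (Nat.lt_succ_self k))
  · have htel : ∀ a k, ∑ j ∈ Finset.range k, (D (a + j) - D (a + j + 1)) = D a - D (a + k) := by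
      intro a k
      simpa [add_assoc] using Finset.sum_range_sub' (fun j ↦ D (a + j)) k
    -- The second difference compares two runs of `n` consecutive decrements, from `m` and from `m +
    -- n`.
    have hlt : ∑ j ∈ Finset.range n, (D (m + n + j) - D (m + n + j + 1)) <
        ∑ j ∈ Finset.range n, (D (m + j) - D (m + j + 1)) := by
      refine Finset.sum_lt_sum_of_nonempty (Finset.nonempty_range_iff.2 (by omega)) fun j _ ↦ ?_
      have := hanti (show m + j - 1 < m + n + j - 1 by omega)
      simp only [show m + j - 1 + 1 = m + j by omega, show m + j - 1 + 2 = m + j + 1 by omega,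
        show m + n + j - 1 + 1 = m + n + j by omega,
        show m + n + j - 1 + 2 = m + n + j + 1 by omega] at this
      exact this
    rw [htel, htel, add_assoc, ← two_mul] at hlt
    linarith

/-- The remainder of the Euler–Maclaurin expansion of the harmonic numbers after the
term `-1 / (12 m ^ 2)`. -/
noncomputable def harmonicTail (m : ℕ) : ℝ :=
  (harmonic m : ℝ) - Real.log m - Real.eulerMascheroniConstant - 1 / (2 * m) + 1 / (12 * m ^ 2)

theorem tendsto_harmonicTail : Tendsto harmonicTail atTop (𝓝 0) := by
  have h1 : Tendsto (fun m : ℕ ↦ 1 / (m : ℝ)) atTop (𝓝 0) := tendsto_one_div_atTop_nhds_zero_nat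
  have h := (((Real.tendsto_harmonic_sub_log.sub_const Real.eulerMascheroniConstant).sub
    (h1.const_mul (1 / 2))).add ((h1.pow 2).const_mul (1 / 12)))
  simp only [sub_self, mul_zero, ne_eq, OfNat.ofNat_ne_zero, not_false_eq_true, zero_pow,
    add_zero] at h
  refine h.congr fun m ↦ ?_
  unfold harmonicTail
  ring

/-- The decrement `harmonicTail m - harmonicTail (m + 1)` as a function of a real variable. -/
noncomputable def tailDecrement (x : ℝ) : ℝ :=
  Real.log (x + 1) - Real.log x - (1 / x + 1 / (x + 1)) / 2 + (1 / x ^ 2 - 1 / (x + 1) ^ 2) / 12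

theorem harmonicTail_sub_succ {m : ℕ} (hm : 1 ≤ m) :
    harmonicTail m - harmonicTail (m + 1) = tailDecrement m := by
  have : (0 : ℝ) < m := by exact_mod_cast hm
  simp only [harmonicTail, tailDecrement, harmonic_succ]
  push_cast
  field_simp
  ring

/-- With `u = x(x+1)` the three groups contribute `-1/u`, `1/u + 1/(2u²)` and `-1/(2u²) - 1/(6u³)`.
-/
theorem hasDerivAt_tailDecrement {x : ℝ} (hx : 0 < x) :
    HasDerivAt tailDecrement (-1 / (6 * (x * (x + 1)) ^ 3)) x := by
  have hx1 : x + 1 ≠ 0 := by positivity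
  have hi : HasDerivAt (fun y : ℝ ↦ y + 1) 1 x := (hasDerivAt_id' x).add_const 1
  have h := (((hi.log hx1).sub (Real.hasDerivAt_log hx.ne')).sub
    (((hasDerivAt_inv hx.ne').add (hi.inv hx1)).div_const 2)).add
    (((((hasDerivAt_id' x).pow 2).inv (by simpa using hx.ne')).sub
      ((hi.pow 2).inv (by simpa using hx1))).div_const 12)
  refine (h.congr_deriv ?_).congr_of_eventuallyEq (.of_forall fun y ↦ ?_)
  · simp
    field_simp
    ring
  · simp [tailDecrement]

/-- The quartic part contributes `-(5u² + 5u + 1)/(30u⁵)` with `u = x(x+1)`; the factor `1/120`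
makes `5u²` cancel against `1/(6u³)`. -/
theorem hasDerivAt_quartic_sub_tailDecrement {x : ℝ} (hx : 0 < x) :
    HasDerivAt (fun x ↦ (1 / x ^ 4 - 1 / (x + 1) ^ 4) / 120 - tailDecrement x)
      (-(5 * (x * (x + 1)) + 1) / (30 * (x * (x + 1)) ^ 5)) x := by
  have hx1 : x + 1 ≠ 0 := by positivity
  have hi : HasDerivAt (fun y : ℝ ↦ y + 1) 1 x := (hasDerivAt_id' x).add_const 1
  have h := (((((hasDerivAt_id' x).pow 4).inv (by simpa using hx.ne')).sub
      ((hi.pow 4).inv (by simpa using hx1))).div_const 120).sub (hasDerivAt_tailDecrement hx)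
  refine (h.congr_deriv ?_).congr_of_eventuallyEq (.of_forall fun y ↦ ?_)
  · simp
    field_simp
    ring
  · simp

theorem lt_of_hasDerivAt_neg {f f' : ℝ → ℝ} (hf : ∀ x, 0 < x → HasDerivAt f (f' x) x)
    (hf' : ∀ x, 0 < x → f' x < 0) {x : ℝ} (hx : 0 < x) : f (x + 1) < f x := by
  refine strictAntiOn_of_deriv_neg (convex_Ioi 0)
    (fun y hy ↦ (hf y hy).continuousAt.continuousWithinAt) (fun y hy ↦ ?_) hx
    (show 0 < x + 1 by positivity) (by linarith)
  rw [interior_Ioi] at hy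
  rw [(hf y hy).deriv]
  exact hf' y hy

theorem harmonicTail_pos_and_convex :
    (∀ m, 1 ≤ m → 0 < harmonicTail m) ∧ ∀ m n, 1 ≤ m → 1 ≤ n →
      0 < harmonicTail (m + 2 * n) - 2 * harmonicTail (m + n) + harmonicTail m := by
  refine pos_of_decrement_strictAnti (fun m hm ↦ ?_) tendsto_harmonicTail
  rw [harmonicTail_sub_succ hm, show m + 2 = m + 1 + 1 from rfl, harmonicTail_sub_succ (by omega)]
  push_cast
  refine lt_of_hasDerivAt_neg (fun x hx ↦ hasDerivAt_tailDecrement hx) (fun x hx ↦ ?_)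
    (by exact_mod_cast hm)
  exact div_neg_of_neg_of_pos (by norm_num) (by positivity)

/-- The gap between `harmonicTail` and its leading term. -/
noncomputable def harmonicTailGap (m : ℕ) : ℝ := 1 / (120 * m ^ 4) - harmonicTail m

theorem harmonicTailGap_pos_and_convex :
    (∀ m, 1 ≤ m → 0 < harmonicTailGap m) ∧ ∀ m n, 1 ≤ m → 1 ≤ n →
      0 < harmonicTailGap (m + 2 * n) - 2 * harmonicTailGap (m + n) + harmonicTailGap m := by
  have hdec : ∀ m : ℕ, 1 ≤ m → harmonicTailGap m - harmonicTailGap (m + 1) =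
      (1 / (m : ℝ) ^ 4 - 1 / ((m : ℝ) + 1) ^ 4) / 120 - tailDecrement m := by
    intro m hm
    have : (0 : ℝ) < m := by exact_mod_cast hm
    rw [← harmonicTail_sub_succ hm]
    simp only [harmonicTailGap]
    push_cast
    field_simp
    ring
  refine pos_of_decrement_strictAnti (fun m hm ↦ ?_) ?_
  · rw [hdec m hm, show m + 2 = m + 1 + 1 from rfl, hdec _ (by omega)]
    push_cast
    refine lt_of_hasDerivAt_neg (fun x hx ↦ hasDerivAt_quartic_sub_tailDecrement hx)
      (fun x hx ↦ ?_) (by exact_mod_cast hm)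
    exact div_neg_of_neg_of_pos (by nlinarith [mul_pos hx hx]) (by positivity)
  · have h1 : Tendsto (fun m : ℕ ↦ 1 / (m : ℝ)) atTop (𝓝 0) :=
      tendsto_one_div_atTop_nhds_zero_nat
    have h := ((h1.pow 4).const_mul (1 / 120)).sub tendsto_harmonicTail
    simp only [ne_eq, OfNat.ofNat_ne_zero, not_false_eq_true, zero_pow, mul_zero, sub_self] at h
    refine h.congr fun m ↦ ?_
    unfold harmonicTailGap
    ring

/-! ### Partial fractions of the cosecant -/

theorem sum_range_two_mul {M : Type*} [AddCommMonoid M] (f : ℕ → M) (N : ℕ) :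
    ∑ i ∈ Finset.range (2 * N), f i = ∑ i ∈ Finset.range N, (f (2 * i) + f (2 * i + 1)) := by
  induction N with
  | zero => simp
  | succ N ih =>
    rw [show 2 * (N + 1) = 2 * N + 1 + 1 by ring, Finset.sum_range_succ, Finset.sum_range_succ,
      ih, Finset.sum_range_succ, add_assoc]

/-- The Mittag-Leffler expansion of the cotangent on `(0, 1)`, over the reals. -/
theorem tendsto_sum_cot_real {x : ℝ} (h0 : 0 < x) (h1 : x < 1) :
    Tendsto (fun N ↦ ∑ j ∈ Finset.range N, (1 / (x - (j + 1)) + 1 / (x + (j + 1)))) atTop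
      (𝓝 (Real.pi * (Real.cos (Real.pi * x) / Real.sin (Real.pi * x)) - 1 / x)) := by
  have hx : (x : ℂ) ∈ Complex.integerComplement := by
    rintro ⟨k, hk⟩
    have hk' : (k : ℝ) = x := by exact_mod_cast hk
    rw [← hk'] at h0 h1
    have h2 : 0 < k := by exact_mod_cast h0
    have h3 : k < 1 := by exact_mod_cast h1
    omega
  have h := (Complex.continuous_re.tendsto _).comp (tendsto_logDeriv_euler_cot_sub hx)
  have hlim : (Real.pi * Complex.cot (Real.pi * x) - 1 / x : ℂ) =
      ((Real.pi * (Real.cos (Real.pi * x) / Real.sin (Real.pi * x)) - 1 / x : ℝ) : ℂ) := by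
    rw [Complex.cot]
    push_cast
    rfl
  rw [hlim, Complex.ofReal_re] at h
  refine h.congr fun N ↦ ?_
  have : (∑ j ∈ Finset.range N, cotTerm (x : ℂ) j) =
      ((∑ j ∈ Finset.range N, (1 / (x - (j + 1)) + 1 / (x + (j + 1))) : ℝ) : ℂ) := by
    push_cast
    rfl
  rw [Function.comp_apply, this, Complex.ofReal_re]

/-- The partial fraction expansion of the cosecant on `(0, 1)`. -/
theorem tendsto_sum_csc {x : ℝ} (h0 : 0 < x) (h1 : x < 1) :
    Tendsto (fun N ↦ 1 / x + ∑ i ∈ Finset.range N,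
      ((1 / (x - (2 * i + 2)) + 1 / (x + (2 * i + 2))) -
        (1 / (x - (2 * i + 1)) + 1 / (x + (2 * i + 1))))) atTop
      (𝓝 (Real.pi * (1 / Real.sin (Real.pi * x)))) := by
  -- `csc y = cot (y/2) - cot y`; the second series is cut at `2N` terms so that its poles pair with
  -- those of the first.
  have hA := tendsto_sum_cot_real (x := x / 2) (by positivity) (by linarith)
  have hB := (tendsto_sum_cot_real h0 h1).comp
    (tendsto_id.const_mul_atTop' (show 0 < 2 by norm_num))
  have h := (hA.sub hB).const_add (1 / x)
  have hs : Real.sin (Real.pi * (x / 2)) ≠ 0 :=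
    (Real.sin_pos_of_pos_of_lt_pi (by positivity) (by nlinarith [Real.pi_pos])).ne'
  have hc : Real.cos (Real.pi * (x / 2)) ≠ 0 :=
    (Real.cos_pos_of_mem_Ioo ⟨by nlinarith [Real.pi_pos], by nlinarith [Real.pi_pos]⟩).ne'
  have hlim : 1 / x + (Real.pi * (Real.cos (Real.pi * (x / 2)) / Real.sin (Real.pi * (x / 2))) -
      1 / (x / 2) - (Real.pi * (Real.cos (Real.pi * x) / Real.sin (Real.pi * x)) - 1 / x)) =
      Real.pi * (1 / Real.sin (Real.pi * x)) := by
    rw [show Real.pi * x = 2 * (Real.pi * (x / 2)) by ring, Real.sin_two_mul, Real.cos_two_mul]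
    generalize Real.pi * (x / 2) = y at hs hc ⊢
    field_simp
    ring
  rw [hlim] at h
  refine h.congr fun N ↦ ?_
  simp only [Function.comp_apply, id]
  rw [sum_range_two_mul, ← Finset.sum_sub_distrib]
  congr 1
  refine Finset.sum_congr rfl fun i _ ↦ ?_
  have e1 : 1 / (x / 2 - ((i : ℝ) + 1)) = 2 * (1 / (x - (2 * i + 2))) := by
    rw [show x / 2 - ((i : ℝ) + 1) = (x - (2 * i + 2)) / 2 by ring, one_div_div]; ring
  have e2 : 1 / (x / 2 + ((i : ℝ) + 1)) = 2 * (1 / (x + (2 * i + 2))) := by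
    rw [show x / 2 + ((i : ℝ) + 1) = (x + (2 * i + 2)) / 2 by ring, one_div_div]; ring
  rw [e1, e2]
  push_cast
  rw [show (2 * (i : ℝ) + 1 + 1) = 2 * i + 2 by ring]
  ring

/-! ### The cosecant sum as a series of harmonic blocks -/

/-- The sum of the reciprocals of the integers strictly between `k n` and `(k + 1) n`. -/
noncomputable def blockSum (n k : ℕ) : ℝ := ∑ l ∈ Finset.Ico 1 n, 1 / ((k : ℝ) * n + l)

theorem sum_one_div_add {n : ℕ} (hn : 1 ≤ n) (m : ℕ) :
    ∑ l ∈ Finset.Ico 1 n, 1 / ((m : ℝ) + l) =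
      (harmonic (m + n) : ℝ) - harmonic m - 1 / (m + n) := by
  induction n, hn using Nat.le_induction with
  | base => simp [harmonic_succ]
  | succ n hn ih =>
    rw [Finset.sum_Ico_succ_top hn, ih, ← add_assoc, harmonic_succ]
    push_cast
    rw [add_assoc]
    simp only [one_div]
    ring

theorem blockSum_eq {n : ℕ} (hn : 1 ≤ n) (k : ℕ) :
    blockSum n k = (harmonic ((k + 1) * n) : ℝ) - harmonic (k * n) - 1 / ((k + 1) * n) := by
  have h := sum_one_div_add hn (k * n)
  rw [show k * n + n = (k + 1) * n by ring] at h
  push_cast at h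
  rw [blockSum, h]
  ring

theorem blockSum_reflect (n k : ℕ) :
    ∑ l ∈ Finset.Ico 1 n, 1 / (((k : ℝ) + 1) * n - l) = blockSum n k := by
  unfold blockSum
  refine Finset.sum_nbij' (fun l ↦ n - l) (fun l ↦ n - l) ?_ ?_ ?_ ?_ ?_
  · intro l hl; simp only [Finset.mem_Ico] at hl ⊢; omega
  · intro l hl; simp only [Finset.mem_Ico] at hl ⊢; omega
  · intro l hl; simp only [Finset.mem_Ico] at hl; omega
  · intro l hl; simp only [Finset.mem_Ico] at hl; omega
  · intro l hl
    simp only [Finset.mem_Ico] at hl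
    rw [Nat.cast_sub hl.2.le]
    congr 1
    ring

theorem tendsto_blockSum (n : ℕ) (hn : 1 ≤ n) : Tendsto (blockSum n) atTop (𝓝 0) := by
  have hn' : (0 : ℝ) < n := by exact_mod_cast hn
  have h : Tendsto (fun k : ℕ ↦ ∑ l ∈ Finset.Ico 1 n, 1 / ((k : ℝ) * n + l)) atTop
      (𝓝 (∑ l ∈ Finset.Ico 1 n, 0)) := by
    refine tendsto_finsetSum _ fun l _ ↦ ?_
    simp only [one_div]
    exact tendsto_inv_atTop_zero.comp (tendsto_atTop_add_const_right _ _
      (tendsto_natCast_atTop_atTop.atTop_mul_const hn'))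
  rw [Finset.sum_const_zero] at h
  exact h

theorem sum_partialFraction {n : ℕ} (hn : 1 ≤ n) (k : ℕ) :
    ∑ l ∈ Finset.Ico 1 n,
      (1 / ((l : ℝ) / n - ((k : ℝ) + 1)) + 1 / ((l : ℝ) / n + ((k : ℝ) + 1))) =
      n * (blockSum n (k + 1) - blockSum n k) := by
  have hn' : (0 : ℝ) < n := by exact_mod_cast hn
  rw [← blockSum_reflect n k, blockSum, ← Finset.sum_sub_distrib, Finset.mul_sum]
  refine Finset.sum_congr rfl fun l hl ↦ ?_
  rw [show (l : ℝ) / n - ((k : ℝ) + 1) = -((((k : ℝ) + 1) * n - l) / n) by field_simp; ring,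
    show (l : ℝ) / n + ((k : ℝ) + 1) = (((k : ℝ) + 1) * n + l) / n by field_simp; ring,
    one_div_neg_eq_neg_one_div, one_div_div, one_div_div]
  push_cast
  ring

theorem tendsto_cscSum {n : ℕ} (hn : 1 ≤ n) :
    Tendsto (fun N ↦ n * (blockSum n 0 + ∑ i ∈ Finset.range N,
      (blockSum n (2 * i + 2) - blockSum n (2 * i + 1)))) atTop
      (𝓝 (Real.pi * cscSum n / 2)) := by
  have hn' : (0 : ℝ) < n := by exact_mod_cast hn
  have h : Tendsto (fun N ↦ ∑ l ∈ Finset.Ico 1 n, (1 / ((l : ℝ) / n) + ∑ i ∈ Finset.range N,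
      ((1 / ((l : ℝ) / n - (2 * i + 2)) + 1 / ((l : ℝ) / n + (2 * i + 2))) -
        (1 / ((l : ℝ) / n - (2 * i + 1)) + 1 / ((l : ℝ) / n + (2 * i + 1)))))) atTop
      (𝓝 (∑ l ∈ Finset.Ico 1 n, Real.pi * (1 / Real.sin (Real.pi * ((l : ℝ) / n))))) := by
    refine tendsto_finsetSum _ fun l hl ↦ ?_
    rw [Finset.mem_Ico] at hl
    have hl1 : (0 : ℝ) < l := by exact_mod_cast hl.1
    have hl2 : (l : ℝ) < n := by exact_mod_cast hl.2
    exact tendsto_sum_csc (by positivity) ((div_lt_one hn').2 hl2)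
  -- Up to the factor `n`, the summed partial series is `2 (b_0 + ∑ (b_{2i+2} - b_{2i+1})) -
  -- b_{2N}`; adding the vanishing `b_{2N}` and halving leaves the claim.
  have hb := ((tendsto_blockSum n hn).comp
    (tendsto_id.const_mul_atTop' (show 0 < 2 by norm_num))).const_mul (n : ℝ)
  have hlim := (h.add hb).div_const 2
  have e : ((∑ l ∈ Finset.Ico 1 n, Real.pi * (1 / Real.sin (Real.pi * ((l : ℝ) / n)))) +
      n * 0) / 2 = Real.pi * cscSum n / 2 := by
    rw [cscSum, Finset.mul_sum]
    simp only [mul_div_assoc, mul_zero, add_zero]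
  rw [e] at hlim
  refine hlim.congr fun N ↦ ?_
  rw [Finset.sum_add_distrib, Finset.sum_comm]
  have h0 : ∑ l ∈ Finset.Ico 1 n, 1 / ((l : ℝ) / n) = n * blockSum n 0 := by
    rw [blockSum, Finset.mul_sum]
    refine Finset.sum_congr rfl fun l _ ↦ ?_
    rw [one_div_div]
    simp [div_eq_mul_inv]
  have hi : ∀ i : ℕ, ∑ l ∈ Finset.Ico 1 n,
      ((1 / ((l : ℝ) / n - (2 * i + 2)) + 1 / ((l : ℝ) / n + (2 * i + 2))) -
        (1 / ((l : ℝ) / n - (2 * i + 1)) + 1 / ((l : ℝ) / n + (2 * i + 1)))) =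
      n * (2 * (blockSum n (2 * i + 2) - blockSum n (2 * i + 1)) -
        (blockSum n (2 * (i + 1)) - blockSum n (2 * i))) := by
    intro i
    rw [Finset.sum_sub_distrib]
    have e1 := sum_partialFraction hn (2 * i + 1)
    have e2 := sum_partialFraction hn (2 * i)
    push_cast at e1 e2
    rw [show (2 * (i : ℝ) + 1 + 1) = 2 * i + 2 by ring] at e1
    rw [e1, e2, show 2 * (i + 1) = 2 * i + 1 + 1 by ring]
    ring
  rw [h0, Finset.sum_congr rfl fun i _ ↦ hi i, ← Finset.mul_sum, Finset.sum_sub_distrib,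
    Finset.sum_range_sub (fun i ↦ blockSum n (2 * i)), ← Finset.mul_sum]
  simp only [Function.comp_apply, id]
  ring

/-! ### Extraction of the main terms -/

theorem harmonic_eq_add_harmonicTail (m : ℕ) : (harmonic m : ℝ) =
    Real.log m + Real.eulerMascheroniConstant + 1 / (2 * m) - 1 / (12 * m ^ 2) +
      harmonicTail m := by
  unfold harmonicTail
  ring

/-- The second difference, with step `1`, of `1 / x ^ p` at `2 i + 1`. -/
noncomputable def oddSecondDiff (p i : ℕ) : ℝ :=
  1 / (2 * (i : ℝ) + 3) ^ p - 2 * (1 / (2 * (i : ℝ) + 2) ^ p) + 1 / (2 * (i : ℝ) + 1) ^ p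

theorem hasSum_oddSecondDiff {p : ℕ} (hp : p ≠ 0) {z : ℝ}
    (hz : HasSum (fun n : ℕ ↦ (1 : ℝ) / (n : ℝ) ^ p) z) :
    HasSum (oddSecondDiff p) (2 * z - 4 * (z / 2 ^ p) - 1) := by
  have heven : HasSum (fun i : ℕ ↦ (1 : ℝ) / (2 * (i : ℝ)) ^ p) (z / 2 ^ p) := by
    refine (hz.div_const (2 ^ p)).congr_fun fun i ↦ ?_
    rw [mul_pow, div_div, mul_comm]
  have hodd : HasSum (fun i : ℕ ↦ (1 : ℝ) / (2 * (i : ℝ) + 1) ^ p) (z - z / 2 ^ p) := by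
    have hs : Summable fun i : ℕ ↦ (1 : ℝ) / (2 * (i : ℝ) + 1) ^ p := by
      have := hz.summable.comp_injective (i := fun i : ℕ ↦ 2 * i + 1)
        (fun a b h ↦ by simpa using h)
      refine this.congr fun i ↦ ?_
      simp
    have h := HasSum.even_add_odd (f := fun n : ℕ ↦ (1 : ℝ) / (n : ℝ) ^ p) (m := z / 2 ^ p)
      (m' := ∑' i : ℕ, (1 : ℝ) / (2 * (i : ℝ) + 1) ^ p) (by simpa using heven)
      (by simpa using hs.hasSum)
    have e := h.unique hz
    rw [← eq_sub_of_add_eq' e]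
    exact hs.hasSum
  have h2 := (hasSum_nat_add_iff' 1).2 heven
  have h3 := (hasSum_nat_add_iff' 1).2 hodd
  -- The dropped odd term is `1`; the dropped even term `1 / 0 ^ p` is `0` because `p ≠ 0`.
  simp [hp] at h2 h3
  have h := (h3.sub (h2.mul_left 2)).add hodd
  rw [show 2 * z - 4 * (z / 2 ^ p) - 1 =
    z - z / 2 ^ p - 1 - 2 * (z / 2 ^ p) + (z - z / 2 ^ p) by ring]
  refine h.congr_fun fun i ↦ ?_
  simp only [oddSecondDiff, one_div]
  rw [show 2 * ((i : ℝ) + 1) + 1 = 2 * i + 3 by ring, show 2 * ((i : ℝ) + 1) = 2 * i + 2 by ring]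

theorem sum_log_eq_neg_log_wallis (N : ℕ) :
    ∑ i ∈ Finset.range N, (Real.log (2 * (i : ℝ) + 3) - 2 * Real.log (2 * (i : ℝ) + 2) +
      Real.log (2 * (i : ℝ) + 1)) = -Real.log (Real.Wallis.W N) := by
  induction N with
  | zero => simp [Real.Wallis.W]
  | succ N ih =>
    rw [Finset.sum_range_succ, ih, Real.Wallis.W_succ,
      Real.log_mul (Real.Wallis.W_pos N).ne' (by positivity),
      Real.log_mul (by positivity) (by positivity),
      Real.log_div (by positivity) (by positivity), Real.log_div (by positivity) (by positivity)]
    ring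

theorem blockSum_eq_tail {n : ℕ} (hn : 1 ≤ n) {k : ℕ} (hk : 1 ≤ k) :
    blockSum n k = Real.log (k + 1) - Real.log k - (1 / ((k : ℝ) + 1) + 1 / k) / (2 * n) -
      (1 / ((k : ℝ) + 1) ^ 2 - 1 / k ^ 2) / (12 * n ^ 2) +
      (harmonicTail ((k + 1) * n) - harmonicTail (k * n)) := by
  have hn' : (0 : ℝ) < n := by exact_mod_cast hn
  have hk' : (0 : ℝ) < k := by exact_mod_cast hk
  rw [blockSum_eq hn, harmonic_eq_add_harmonicTail, harmonic_eq_add_harmonicTail]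
  push_cast
  rw [Real.log_mul (by positivity) (by positivity), Real.log_mul (by positivity) (by positivity)]
  field_simp
  ring

/-- The second difference of `f`, with step `n`, at `(2 i + 1) n`. -/
noncomputable def blockSecondDiff (f : ℕ → ℝ) (n i : ℕ) : ℝ :=
  f ((2 * i + 1) * n + 2 * n) - 2 * f ((2 * i + 1) * n + n) + f ((2 * i + 1) * n)

/-- The `1/m` terms at the middle point `2i + 2` cancel; the cast of `i + 1` lets the rest telescope
by `Finset.sum_range_sub`. -/
theorem blockSum_sub {n : ℕ} (hn : 1 ≤ n) (i : ℕ) :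
    blockSum n (2 * i + 2) - blockSum n (2 * i + 1) =
      (Real.log (2 * (i : ℝ) + 3) - 2 * Real.log (2 * (i : ℝ) + 2) +
        Real.log (2 * (i : ℝ) + 1)) -
      (1 / (2 * ((i + 1 : ℕ) : ℝ) + 1) - 1 / (2 * (i : ℝ) + 1)) / (2 * n) -
      oddSecondDiff 2 i / (12 * n ^ 2) + blockSecondDiff harmonicTail n i := by
  rw [blockSum_eq_tail hn (by omega), blockSum_eq_tail hn (by omega), oddSecondDiff,
    blockSecondDiff, show (2 * i + 1) * n + 2 * n = (2 * i + 2 + 1) * n by ring,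
    show (2 * i + 1) * n + n = (2 * i + 1 + 1) * n by ring]
  push_cast
  rw [show 2 * (i : ℝ) + 2 + 1 = 2 * i + 3 by ring, show 2 * (i : ℝ) + 1 + 1 = 2 * i + 2 by ring,
    show 2 * ((i : ℝ) + 1) + 1 = 2 * i + 3 by ring]
  ring

theorem tendsto_sum_blockSecondDiff {n : ℕ} (hn : 1 ≤ n) :
    Tendsto (fun N ↦ ∑ i ∈ Finset.range N, blockSecondDiff harmonicTail n i) atTop
      (𝓝 (Real.pi / (2 * n) * (cscSum n - 2 * (n : ℝ) / Real.pi *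
        ((harmonic n : ℝ) - Real.log (Real.pi / 2)) + 1 / Real.pi + constA / n))) := by
  have hn' : (0 : ℝ) < n := by exact_mod_cast hn
  have hpi := Real.pi_pos
  have h1 := (tendsto_cscSum hn).const_mul (1 / (n : ℝ))
  have h2 := (Real.continuousAt_log (show Real.pi / 2 ≠ 0 by positivity)).tendsto.comp
    Real.Wallis.tendsto_W_nhds_pi_div_two
  have h3 : Tendsto (fun N : ℕ ↦ 1 / (2 * (N : ℝ) + 1)) atTop (𝓝 0) := by
    simp only [one_div]
    exact tendsto_inv_atTop_zero.comp (tendsto_atTop_add_const_right _ _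
      (tendsto_natCast_atTop_atTop.const_mul_atTop (by norm_num)))
  have h4 := (hasSum_oddSecondDiff two_ne_zero hasSum_zeta_two).tendsto_sum_nat
  have h := (((h1.sub_const (blockSum n 0)).add h2).add
    ((h3.sub_const 1).div_const (2 * (n : ℝ)))).add (h4.div_const (12 * (n : ℝ) ^ 2))
  convert h.congr fun N ↦ ?_ using 2
  · rw [blockSum_eq hn]
    simp only [constA]
    simp
    field_simp
    ring
  · rw [Finset.sum_congr rfl fun i _ ↦ blockSum_sub hn i, Finset.sum_add_distrib,
      Finset.sum_sub_distrib, Finset.sum_sub_distrib, sum_log_eq_neg_log_wallis,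
      ← Finset.sum_div, ← Finset.sum_div,
      Finset.sum_range_sub (fun i : ℕ ↦ 1 / (2 * (i : ℝ) + 1)), Function.comp_apply]
    simp only [Nat.cast_zero, mul_zero, zero_add, div_one]
    field_simp
    ring

/-! ### The bounds and their comparison -/

theorem pos_of_tendsto_sum {f : ℕ → ℝ} (hf : ∀ i, 0 < f i) {s : ℝ}
    (h : Tendsto (fun N ↦ ∑ i ∈ Finset.range N, f i) atTop (𝓝 s)) : 0 < s := by
  have hmono : Monotone fun N ↦ ∑ i ∈ Finset.range N, f i :=
    monotone_nat_of_le_succ fun N ↦ by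
      rw [Finset.sum_range_succ]
      linarith [hf N]
  have := hmono.ge_of_tendsto h 1
  rw [Finset.sum_range_one] at this
  exact (hf 0).trans_le this

theorem neg_constA_div_lt {n : ℕ} (hn : 1 ≤ n) :
    -constA / (n : ℝ) < cscSum n - 2 * (n : ℝ) / Real.pi *
      ((harmonic n : ℝ) - Real.log (Real.pi / 2)) + 1 / Real.pi := by
  have hn' : (0 : ℝ) < n := by exact_mod_cast hn
  have h := pos_of_tendsto_sum (fun i ↦ harmonicTail_pos_and_convex.2 ((2 * i + 1) * n) n
    (Nat.mul_pos (by omega) hn) hn) (tendsto_sum_blockSecondDiff hn)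
  have := pos_of_mul_pos_right h (by positivity)
  rw [neg_div]
  linarith

theorem lt_neg_constA_div_add {n : ℕ} (hn : 1 ≤ n) :
    cscSum n - 2 * (n : ℝ) / Real.pi *
      ((harmonic n : ℝ) - Real.log (Real.pi / 2)) + 1 / Real.pi <
      -constA / (n : ℝ) + constB / (n : ℝ) ^ 3 := by
  have hn' : (0 : ℝ) < n := by exact_mod_cast hn
  have hpi := Real.pi_pos
  have h4 := (hasSum_oddSecondDiff four_ne_zero hasSum_zeta_four).tendsto_sum_nat
  have ht := (h4.div_const (120 * (n : ℝ) ^ 4)).sub (tendsto_sum_blockSecondDiff hn)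
  have h := pos_of_tendsto_sum (f := blockSecondDiff harmonicTailGap n)
    (fun i ↦ harmonicTailGap_pos_and_convex.2 ((2 * i + 1) * n) n
      (Nat.mul_pos (by omega) hn) hn) (ht.congr fun N ↦ by
        rw [Finset.sum_div, ← Finset.sum_sub_distrib]
        refine Finset.sum_congr rfl fun i _ ↦ ?_
        simp only [blockSecondDiff, harmonicTailGap, oddSecondDiff]
        push_cast
        rw [show (2 * (i : ℝ) + 1) * n + 2 * n = (2 * i + 3) * n by ring,
          show (2 * (i : ℝ) + 1) * n + n = (2 * i + 2) * n by ring]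
        simp only [mul_pow]
        field_simp
        ring)
  -- The bracket is `7ζ(4)/4 - 1 = 7π⁴/360 - 1`, the source of `B`.
  have e : (2 * (Real.pi ^ 4 / 90) - 4 * (Real.pi ^ 4 / 90 / 2 ^ 4) - 1) / (120 * (n : ℝ) ^ 4) =
      Real.pi / (2 * n) * (constB / (n : ℝ) ^ 3) := by
    simp only [constB]
    field_simp
    ring
  rw [e, ← mul_sub] at h
  have := pos_of_mul_pos_right h (by positivity)
  rw [neg_div]
  linarith

/-- In `H_n` the term `1/(2n)` absorbs `1/π`, and `-1/(12n²)` accounts for `C - A = 1/(6π)`. -/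
theorem harmonicMain_sub_logMain {n : ℕ} (hn : 1 ≤ n) :
    harmonicMain n - constA / n =
      logMain n - constC / n + 2 * (n : ℝ) / Real.pi * harmonicTail n := by
  have hn' : (0 : ℝ) < n := by exact_mod_cast hn
  have hpi := Real.pi_pos
  simp only [harmonicMain, logMain, constA, constC, harmonicTail]
  rw [Real.log_div (by positivity) (by positivity), Real.log_div (by positivity) (by positivity),
    Real.log_mul (by positivity) (by positivity)]
  field_simp
  ring

theorem logMain_lt_harmonicMain {n : ℕ} (hn : 1 ≤ n) :
    logMain n - constC / (n : ℝ) < harmonicMain n - constA / (n : ℝ) := by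
  have hn' : (0 : ℝ) < n := by exact_mod_cast hn
  have := harmonicTail_pos_and_convex.1 n hn
  rw [harmonicMain_sub_logMain hn, lt_add_iff_pos_right]
  positivity

theorem harmonicMain_lt_logMain {n : ℕ} (hn : 1 ≤ n) :
    harmonicMain n - constA / (n : ℝ) + constB / (n : ℝ) ^ 3
      < logMain n - constC / (n : ℝ) + constD / (n : ℝ) ^ 3 := by
  have hn' : (0 : ℝ) < n := by exact_mod_cast hn
  have hpi := Real.pi_pos
  have hg := harmonicTailGap_pos_and_convex.1 n hn
  have h : 0 < 2 * (n : ℝ) / Real.pi * harmonicTailGap n := by positivity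
  -- Here `D - B = 1/(60π) = (2/π)/120`.
  have e : 2 * (n : ℝ) / Real.pi * harmonicTailGap n = constD / (n : ℝ) ^ 3 -
      constB / (n : ℝ) ^ 3 - 2 * (n : ℝ) / Real.pi * harmonicTail n := by
    simp only [harmonicTailGap, constB, constD]
    field_simp
    ring
  rw [harmonicMain_sub_logMain hn]
  linarith

/-! ### Decimals of the constants and conclusion -/

theorem const_bounds :
    (0.0342 < constA ∧ constA < 0.0343) ∧
    (0.00474 < constB ∧ constB < 0.00475) ∧
    (0.0872 < constC ∧ constC < 0.0873) ∧
    (0.0100 < constD ∧ constD < 0.0101) := by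
  have h1 : 3.14159 < Real.pi := lt_trans (by norm_num) Real.pi_gt_d6
  have h2 : Real.pi < 3.1416 := Real.pi_lt_d4
  have hi1 : 1 / 3.1416 < 1 / Real.pi := one_div_lt_one_div_of_lt Real.pi_pos h2
  have hi2 : 1 / Real.pi < 1 / 3.14159 := one_div_lt_one_div_of_lt (by norm_num) h1
  have hc1 : 3.14159 ^ 3 < Real.pi ^ 3 := pow_lt_pow_left₀ h1 (by norm_num) (by norm_num)
  have hc2 : Real.pi ^ 3 < 3.1416 ^ 3 := pow_lt_pow_left₀ h2 Real.pi_pos.le (by norm_num)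
  have e : ∀ c : ℝ, 1 / (c * Real.pi) = 1 / c * (1 / Real.pi) := fun c ↦ by
    rw [one_div_mul_one_div]
  simp only [constA, constB, constC, constD, e]
  norm_num only at *
  refine ⟨⟨?_, ?_⟩, ⟨?_, ?_⟩, ⟨?_, ?_⟩, ?_, ?_⟩ <;> linarith

theorem mainTheorem1 :
    (∀ n : ℕ, 2 ≤ n →
      -- the bounds with the harmonic number
      (-constA / (n : ℝ)
          < cscSum n
            - 2 * (n : ℝ) / Real.pi * ((harmonic n : ℝ) - Real.log (Real.pi / 2))
            + 1 / Real.pi ∧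
        cscSum n
            - 2 * (n : ℝ) / Real.pi * ((harmonic n : ℝ) - Real.log (Real.pi / 2))
            + 1 / Real.pi
          < -constA / (n : ℝ) + constB / (n : ℝ) ^ 3) ∧
      -- the bounds with the logarithm
      (-constC / (n : ℝ)
          < cscSum n
            - 2 * (n : ℝ) / Real.pi *
              (Real.log (2 * (n : ℝ) / Real.pi) + Real.eulerMascheroniConstant) ∧
        cscSum n
            - 2 * (n : ℝ) / Real.pi *
              (Real.log (2 * (n : ℝ) / Real.pi) + Real.eulerMascheroniConstant)
          < -constC / (n : ℝ) + constD / (n : ℝ) ^ 3) ∧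
      -- the bounds for `S_n` with the harmonic number are the more accurate ones, on both sides
      (logMain n - constC / (n : ℝ) < harmonicMain n - constA / (n : ℝ) ∧
        harmonicMain n - constA / (n : ℝ) + constB / (n : ℝ) ^ 3
          < logMain n - constC / (n : ℝ) + constD / (n : ℝ) ^ 3)) ∧
    -- the leading decimals of the four constants
    (0.0342 < constA ∧ constA < 0.0343) ∧
    (0.00474 < constB ∧ constB < 0.00475) ∧
    (0.0872 < constC ∧ constC < 0.0873) ∧
    (0.0100 < constD ∧ constD < 0.0101) := by
  refine ⟨fun n hn ↦ ?_, const_bounds⟩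
  have hn1 : 1 ≤ n := by omega
  have h1 := neg_constA_div_lt hn1
  have h2 := lt_neg_constA_div_add hn1
  have h3 := logMain_lt_harmonicMain hn1
  have h4 := harmonicMain_lt_logMain hn1
  refine ⟨⟨h1, h2⟩, ?_, h3, h4⟩
  simp only [logMain, harmonicMain, neg_div] at *
  constructor <;> linarith
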